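/- Let $m,d\ge 1$, let $A_0,\dots,A_{m-1}$ be real $d\times d$ matrices with non-negative entries, and suppose $A_0=\mathbf u\mathbf v'$ for column vectors $\mathbf u,\mathbf v\in\mathbb R^d$ with $\mathbf v'\mathbf u\neq 0$ (the prime denotes transpose). Let $\Omega=\{0,\dots,m-1\}^{\mathbb N}$ with the left shift $\sigma$. For a finite word $\mathbf w=w_1\cdots w_\ell$ put $A_{\mathbf w}=A_{w_1}\cdots A_{w_\ell}$ (the identity matrix for the empty word) and let $[\mathbf w]\subset\Omega$ be the cylinder of sequences having $\mathbf w$ as prefix. Let $\nu$ be a $\sigma$-invariant ergodic Borel probability measure on $\Omega$ with $\nu([0])>0$, and let $\omega=(\omega_k)_{k\ge0}\in\Omega$ be $\nu$-generic, i.e. $\frac1n\sum_{k=0}^{n-1}\delta_{\sigma^k\omega}\to\nu$ in the weak-* topology (in particular, $0$ occurs infinitely often in $\omega$). Let $\mathbf w_0$ be the (possibly empty) word preceding the first occurrence of $0$ in $\omega$, and let $\mathcal R$ be the set of return words, i.e. of non-empty words $\mathbf w$ not containing the letter $0$ such that $0\mathbf w0$ occurs in $\omega$. Then, for any norm $\|\cdot\|$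 on the space of real $d\times d$ matrices and with the convention $\log 0=-\infty$, the limit $$L(\omega)=\lim_{n\to\infty}\frac1n\log\|A_{\omega_0}A_{\omega_1}\cdots A_{\omega_{n-1}}\|$$ exists in $[-\infty,+\infty)$. Moreover, $L(\omega)=-\infty$ if $A_{\mathbf w_0}\mathbf u=0$ or if $\mathbf v'A_{\mathbf w}\mathbf u=0$ for some $\mathbf w\in\mathcal R$; otherwise $$L(\omega)=\nu([0])\log \mathbf v'\mathbf u+\sum_{\mathbf w\in\mathcal R}\nu([0\mathbf w0])\log\frac{\mathbf v'A_{\mathbf w}\mathbf u}{\mathbf v'\mathbf u},$$ where the series converges absolutely. -/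

import Mathlib

open Filter Topology MeasureTheory

noncomputable section

namespace MatrixWords

/-- The left shift on the space of sequences over the alphabet `{0, …, m-1}`. -/
def shift {m : ℕ} (x : ℕ → Fin m) : ℕ → Fin m := fun n => x (n + 1)

/-- The word `x₀ x₁ ⋯ x_{n-1}`. -/
def initialWord {m : ℕ} (x : ℕ → Fin m) (n : ℕ) : List (Fin m) := (List.range n).map x

/-- The cylinder `[w]`: the sequences having the word `w` as prefix. -/
def wordCylinder {m : ℕ} (w : List (Fin m)) : Set (ℕ → Fin m) :=
  {x | initialWord x w.length = w}

/-- The language of `ω`: the finite words that occur in `ω`. -/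
def language {m : ℕ} (ω : ℕ → Fin m) : Set (List (Fin m)) :=
  {w | ∃ k : ℕ, shift^[k] ω ∈ wordCylinder w}

/-- The return words (to `0`) of `ω`: the nonempty words `w` without the letter `0` such that
`0w0` occurs in `ω`. These are the words `w₁, w₂, …` in the decomposition
`ω = w₀ 0^{t₀} w₁ 0^{t₁} w₂ 0^{t₂} ⋯`. -/
def returnWords {m : ℕ} [NeZero m] (ω : ℕ → Fin m) : Set (List (Fin m)) :=
  {w | w ≠ [] ∧ (0 : Fin m) ∉ w ∧ (0 :: (w ++ [0])) ∈ language ω}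

/-- The word `w₀` (possibly empty) which precedes the first occurrence of `0` in `ω`; it is
used only for sequences `ω` in which the letter `0` occurs. -/
def firstWord {m : ℕ} [NeZero m] (ω : ℕ → Fin m) : List (Fin m) :=
  initialWord ω (sInf {n | ω n = 0})

/-- The matrix product `A_w = A_{w₁} ⋯ A_{w_ℓ}` along a word `w = w₁ ⋯ w_ℓ`. -/
def wordProd {m d : ℕ} (A : Fin m → Matrix (Fin d) (Fin d) ℝ) (w : List (Fin m)) :
    Matrix (Fin d) (Fin d) ℝ :=
  (w.map A).prod

/-- `ω` is `ν`-generic: the empirical measures `(1/n) ∑_{k<n} δ_{σ^k ω}` converge to `ν` in the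
weak-* topology, i.e. when integrated against every continuous function. -/
def IsGeneric {m : ℕ} (ν : Measure (ℕ → Fin m)) (ω : ℕ → Fin m) : Prop :=
  ∀ f : C(ℕ → Fin m, ℝ),
    Tendsto (fun n : ℕ => birkhoffAverage ℝ shift f n ω) atTop (𝓝 (∫ x, f x ∂ν))

/-- `L` is the limit of `(1/n) log ‖A_{ω₀} ⋯ A_{ω_{n-1}}‖` in the extended reals, where the norm
is `N` and `log 0 = -∞`. -/
def IsLyapunovExponent {m d : ℕ} (N : Seminorm ℝ (Matrix (Fin d) (Fin d) ℝ))
    (A : Fin m → Matrix (Fin d) (Fin d) ℝ) (ω : ℕ → Fin m) (L : EReal) : Prop :=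
  Tendsto (fun n : ℕ =>
      ENNReal.log (ENNReal.ofReal (N (wordProd A (initialWord ω n)))) / (n : EReal))
    atTop (𝓝 L)

end MatrixWords

end

/-! Since `A 0 = u v'`, one has `A 0 * M * A 0 = (v' M u) • A 0` for every `M`. Cutting `ω` at its
zeros therefore writes the product as scalars `v' A_w u`, one for each completed run `w` between
consecutive zeros, times a matrix made of the first word, one `A 0` and the unfinished last run
(`wordProd_initialWord_eq_smul`). A vanishing scalar, or `A_{w₀} u = 0`, kills the product from some
point on. Otherwise the logarithm is, up to the tail, a sum over the zeros of `ω`. An empty run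
contributes `log v'u`, which produces the term in `ν [0]`.

Genericity gives the frequency of each single run, but the run length is unbounded, so limit and sum
must be exchanged. Nonzero entries of products of non-negative matrices lie between `exp (-B ℓ)` and
`exp (B ℓ)`, `ℓ` being the length of the word, so logarithms grow at most linearly in `ℓ`. The
letters spent in long completed runs have small density: `sum_long_runs_le` bounds it by the
frequency of zero-free blocks of length `M`, which tends to zero by ergodicity and `ν [0] > 0`. This
yields `IsGeneric.tendsto_return_average`, and likewise makes the tail negligible. -/

namespace MatrixWords

/-! ### Runs between occurrences of `0` -/

section Words

variable {m : ℕ}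

lemma initialWord_succ (x : ℕ → Fin m) (n : ℕ) :
    initialWord x (n + 1) = initialWord x n ++ [x n] := by
  simp [initialWord, List.range_succ]

lemma shift_iterate_apply (k : ℕ) (x : ℕ → Fin m) (n : ℕ) : shift^[k] x n = x (n + k) := by
  induction k generalizing n with
  | zero => rfl
  | succ k ih =>
    rw [Function.iterate_succ_apply', shift, ih]
    congr 1
    omega

/-- The letters read since the last occurrence of `0` among `x₀, …, x_{n-1}`; if there is none,
this is the whole word `x₀ ⋯ x_{n-1}`. -/
def runWord [NeZero m] (x : ℕ → Fin m) : ℕ → List (Fin m)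
  | 0 => []
  | n + 1 => if x n = 0 then [] else runWord x n ++ [x n]

variable [NeZero m] (x : ℕ → Fin m)

lemma runWord_succ_of_eq {n : ℕ} (h : x n = 0) : runWord x (n + 1) = [] := by
  simp [runWord, h]

lemma runWord_succ_of_ne {n : ℕ} (h : x n ≠ 0) :
    runWord x (n + 1) = runWord x n ++ [x n] := by
  simp [runWord, h]

lemma zero_notMem_runWord (n : ℕ) : (0 : Fin m) ∉ runWord x n := by
  induction n with
  | zero => simp [runWord]
  | succ n ih =>
    by_cases h : x n = 0
    · simp [runWord_succ_of_eq x h]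
    · simp [runWord_succ_of_ne x h, ih, Ne.symm h]

lemma length_runWord_lt {i n : ℕ} (hi : x i = 0) (hin : i < n) : (runWord x n).length < n := by
  induction n, hin using Nat.le_induction with
  | base => simp [runWord_succ_of_eq x hi]
  | succ n hn ih =>
    by_cases h : x n = 0
    · simp [runWord_succ_of_eq x h]
    · simpa [runWord_succ_of_ne x h] using ih

/-- The position exceeds `w.length`, which excludes the initial run: before the first zero, the run
at position `n` has length `n`. -/
lemma runWord_eq_iff_initialWord (k : ℕ) (w : List (Fin m)) (hw : (0 : Fin m) ∉ w) :
    runWord x (k + w.length + 1) = w ↔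
      initialWord (shift^[k] x) (w.length + 1) = 0 :: w := by
  induction w using List.reverseRecOn with
  | nil =>
    by_cases h : x k = 0 <;> simp [runWord, initialWord, shift_iterate_apply, h]
  | append_singleton w a ih =>
    simp only [List.mem_append, List.mem_singleton, not_or] at hw
    have ih := ih hw.1
    rw [List.length_append, List.length_singleton, ← add_assoc k, initialWord_succ,
      ← List.cons_append, List.append_singleton_inj, ← ih, shift_iterate_apply,
      show w.length + 1 + k = k + w.length + 1 by omega]
    by_cases h : x (k + w.length + 1) = 0
    · rw [runWord_succ_of_eq x h, h]
      simp [hw.2]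
    · rw [runWord_succ_of_ne x h, List.append_singleton_inj]

lemma zero_and_runWord_eq_iff (k : ℕ) (w : List (Fin m)) (hw : (0 : Fin m) ∉ w) :
    (x (k + (w.length + 1)) = 0 ∧ runWord x (k + (w.length + 1)) = w) ↔
      initialWord (shift^[k] x) (w.length + 2) = 0 :: (w ++ [0]) := by
  rw [initialWord_succ, ← List.cons_append, List.append_singleton_inj, ← add_assoc,
    ← runWord_eq_iff_initialWord x k w hw, shift_iterate_apply,
    show w.length + 1 + k = k + w.length + 1 by omega, and_comm]

lemma cons_runWord_mem_language {i j : ℕ} (hi : x i = 0) (hij : i < j) (hj : x j = 0) :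
    (0 :: (runWord x j ++ [0])) ∈ language x := by
  have hlt := length_runWord_lt x hi hij
  refine ⟨j - ((runWord x j).length + 1), ?_⟩
  have := (zero_and_runWord_eq_iff x (j - ((runWord x j).length + 1)) (runWord x j)
    (zero_notMem_runWord x j)).1
  rw [Nat.sub_add_cancel (by omega)] at this
  simpa [wordCylinder] using this ⟨hj, rfl⟩

lemma runWord_mem_returnWords {i j : ℕ} (hi : x i = 0) (hij : i < j) (hj : x j = 0)
    (hne : runWord x j ≠ []) : runWord x j ∈ returnWords x :=
  ⟨hne, zero_notMem_runWord x j, cons_runWord_mem_language x hi hij hj⟩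

lemma exists_runWord_eq_of_mem_returnWords {w : List (Fin m)} (hw : w ∈ returnWords x) :
    ∃ i j, i < j ∧ x i = 0 ∧ x j = 0 ∧ runWord x j = w := by
  obtain ⟨-, h0, k, hk⟩ := hw
  have hk : initialWord (shift^[k] x) (w.length + 2) = 0 :: (w ++ [0]) := by
    simpa [wordCylinder] using hk
  have h := (zero_and_runWord_eq_iff x k w h0).2 hk
  refine ⟨k, k + (w.length + 1), by omega, ?_, h.1, h.2⟩
  have := congrArg (fun l => l[0]?) hk
  simpa [initialWord, shift_iterate_apply] using this

lemma le_length_runWord_iff (k M : ℕ) :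
    M ≤ (runWord x (k + M)).length ↔ (0 : Fin m) ∉ initialWord (shift^[k] x) M := by
  induction M with
  | zero => simp [initialWord]
  | succ M ih =>
    rw [initialWord_succ, ← add_assoc, shift_iterate_apply, add_comm M k]
    by_cases h : x (k + M) = 0
    · simp [runWord_succ_of_eq x h, h]
    · simp [runWord_succ_of_ne x h, ih, Ne.symm h]

/-- A completed run of length `ℓ ≥ 2 * M` passes through `ℓ - M + 1` positions where the current run
already has length at least `M`, and `ℓ + 1 ≤ 3 * (ℓ - M + 1)`. The second summand credits the
unfinished run, which makes the induction close and also controls the tail. -/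
lemma sum_long_runs_le {M : ℕ} (hM : 1 ≤ M) (n : ℕ) :
    (∑ j ∈ Finset.range n, if x j = 0 ∧ 2 * M ≤ (runWord x j).length
        then (runWord x j).length + 1 else 0) + 3 * ((runWord x n).length - M) ≤
      3 * ∑ j ∈ Finset.range n, if M ≤ (runWord x j).length then 1 else 0 := by
  induction n with
  | zero => simp [runWord]
  | succ n ih =>
    rw [Finset.sum_range_succ, Finset.sum_range_succ]
    by_cases h : x n = 0
    · rw [runWord_succ_of_eq x h]
      simp only [h, true_and, List.length_nil]
      split_ifs <;> omega
    · rw [runWord_succ_of_ne x h]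
      simp only [h, false_and, List.length_append, List.length_singleton, if_false]
      split_ifs <;> omega

lemma sum_runs_add_length (n : ℕ) :
    (∑ j ∈ Finset.range n, if x j = 0 then (runWord x j).length + 1 else 0) +
      (runWord x n).length = n := by
  induction n with
  | zero => simp [runWord]
  | succ n ih =>
    rw [Finset.sum_range_succ]
    by_cases h : x n = 0
    · rw [runWord_succ_of_eq x h]
      simp only [h, if_true, List.length_nil]
      omega
    · rw [runWord_succ_of_ne x h]
      simp only [h, List.length_append, List.length_singleton, if_false]
      omega

end Words

/-! ### Cesàro averages and exchange of limits -/

section Averages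

/-- Passes from the position where a pattern starts to the position where it has been read; the
first `r` terms do not affect the limit. -/
lemma tendsto_average_of_add_eq {y z : ℕ → ℝ} {r : ℕ} {L : ℝ} (hz : ∀ k, z (k + r) = y k)
    (hy : Tendsto (fun n : ℕ => (∑ k ∈ Finset.range n, y k) / n) atTop (𝓝 L)) :
    Tendsto (fun n : ℕ => (∑ k ∈ Finset.range n, z k) / n) atTop (𝓝 L) := by
  rw [← tendsto_add_atTop_iff_nat r]
  have h1 : Tendsto (fun n : ℕ => (n : ℝ) / ((n + r : ℕ) : ℝ)) atTop (𝓝 1) := by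
    simpa using tendsto_natCast_div_add_atTop (𝕜 := ℝ) (r : ℝ)
  have h2 : Tendsto (fun n : ℕ => (∑ k ∈ Finset.range r, z k) / ((n + r : ℕ) : ℝ)) atTop (𝓝 0) :=
    (tendsto_add_atTop_iff_nat r).2 (tendsto_const_div_atTop_nhds_zero_nat _)
  have h3 := h2.add (hy.mul h1)
  rw [zero_add, mul_one] at h3
  refine h3.congr' ?_
  filter_upwards [eventually_ge_atTop 1] with n hn
  have hn' : (n : ℝ) ≠ 0 := by positivity
  rw [add_comm n r, Finset.sum_range_add, add_div]
  congr 1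
  rw [div_mul_div_cancel₀ hn']
  congr 1
  exact Finset.sum_congr rfl fun k _ => by rw [add_comm, hz]

lemma tendsto_of_approx {x : ℕ → ℝ} {y e : ℕ → ℕ → ℝ} {Y β : ℕ → ℝ} {s : ℝ}
    (hy : ∀ M, Tendsto (y M) atTop (𝓝 (Y M))) (he : ∀ M, Tendsto (e M) atTop (𝓝 (β M)))
    (hx : ∀ᶠ M in atTop, ∀ n, |x n - y M n| ≤ e M n)
    (hY : Tendsto Y atTop (𝓝 s)) (hβ : Tendsto β atTop (𝓝 0)) : Tendsto x atTop (𝓝 s) := by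
  rw [Metric.tendsto_atTop']
  intro ε hε
  have h1 := (Metric.tendsto_nhds.1 hY) (ε / 4) (by positivity)
  have h2 := (Metric.tendsto_nhds.1 hβ) (ε / 4) (by positivity)
  obtain ⟨M, hM1, hM2, hM3⟩ := (h1.and (h2.and hx)).exists
  have h3 := (Metric.tendsto_nhds.1 (hy M)) (ε / 4) (by positivity)
  have h4 := (Metric.tendsto_nhds.1 (he M)) (ε / 4) (by positivity)
  obtain ⟨n₀, h5⟩ := eventually_atTop.1 (h3.and h4)
  refine ⟨n₀, fun n hn => ?_⟩
  obtain ⟨h6, h7⟩ := h5 n hn.le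
  have h8 := hM3 n
  simp only [Real.dist_eq, abs_lt, abs_le] at *
  constructor <;> linarith [h8.1, h8.2, h6.1, h6.2, h7.1, h7.2, hM1.1, hM1.2, hM2.1, hM2.2]

end Averages

/-! ### Frequencies of words along a generic sequence -/

section Generic

variable {m : ℕ} {ν : Measure (ℕ → Fin m)} {ω : ℕ → Fin m}

lemma isClopen_initialWord (n : ℕ) (p : List (Fin m) → Prop) :
    IsClopen {x : ℕ → Fin m | p (initialWord x n)} := by
  have h : {x : ℕ → Fin m | p (initialWord x n)} =
      (fun (x : ℕ → Fin m) (i : Fin n) => x i) ⁻¹' {y | p (List.ofFn y)} := by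
    ext x
    have : initialWord x n = List.ofFn fun i : Fin n => x i := by
      apply List.ext_getElem <;> simp [initialWord]
    simp [this]
  rw [h]
  exact (isClopen_discrete _).preimage (by fun_prop)

lemma measurableSet_initialWord (n : ℕ) (p : List (Fin m) → Prop) :
    MeasurableSet {x : ℕ → Fin m | p (initialWord x n)} :=
  (isClopen_initialWord n p).isOpen.measurableSet

lemma IsGeneric.tendsto_frequency (hω : IsGeneric ν ω) (n : ℕ) (p : List (Fin m) → Prop)
    [DecidablePred p] :
    Tendsto (fun N : ℕ =>
      (∑ k ∈ Finset.range N, if p (initialWord (shift^[k] ω) n) then (1 : ℝ) else 0) / N)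
      atTop (𝓝 (ν.real {x | p (initialWord x n)})) := by
  have hc := isClopen_initialWord n p
  -- A clopen set has empty frontier, so its indicator is an admissible test function.
  let f : C(ℕ → Fin m, ℝ) := ⟨Set.indicator {x | p (initialWord x n)} 1,
    (continuous_one).indicator (by simp [hc.frontier_eq])⟩
  have h := hω f
  have hf : ∫ x, f x ∂ν = ν.real {x | p (initialWord x n)} :=
    integral_indicator_one (measurableSet_initialWord n p)
  rw [hf] at h
  refine h.congr fun N => ?_
  rw [birkhoffAverage, birkhoffSum, smul_eq_mul, inv_mul_eq_div]
  congr 1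
  exact Finset.sum_congr rfl fun k _ => by simp [f, Set.indicator_apply]

end Generic

/-! ### Frequencies of returns and averages over return words -/

section Generic

variable {m : ℕ} [NeZero m] {ν : Measure (ℕ → Fin m)} {ω : ℕ → Fin m}

lemma tendsto_measureReal_zero_notMem [IsProbabilityMeasure ν] (hν : Ergodic shift ν)
    (hν0 : 0 < ν (wordCylinder [0])) :
    Tendsto (fun M => ν.real {x | (0 : Fin m) ∉ initialWord x M}) atTop (𝓝 0) := by
  have hmeas : ∀ M, MeasurableSet {x : ℕ → Fin m | (0 : Fin m) ∉ initialWord x M} :=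
    fun M => measurableSet_initialWord M fun w => (0 : Fin m) ∉ w
  have hZ : (⋂ M, {x : ℕ → Fin m | (0 : Fin m) ∉ initialWord x M}) = {x | ∀ n, x n ≠ 0} := by
    ext x
    simp only [initialWord, Set.mem_iInter, Set.mem_ofPred_eq, List.mem_map, List.mem_range,
      not_exists, not_and]
    exact ⟨fun h n => h (n + 1) n (by omega), fun h _ n _ => h n⟩
  have hcyl : (wordCylinder [0] : Set (ℕ → Fin m)) = {x | x 0 = 0} := by
    ext x
    simp [wordCylinder, initialWord]
  have h0 : ν {x : ℕ → Fin m | ∀ n, x n ≠ 0} = 0 := by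
    have hm : NullMeasurableSet {x : ℕ → Fin m | ∀ n, x n ≠ 0} ν := by
      rw [← hZ]
      exact (MeasurableSet.iInter hmeas).nullMeasurableSet
    -- The zero-free sequences are mapped into themselves by the shift, so they form a null or a
    -- conull set; the latter contradicts `ν [0] > 0`.
    rcases hν.ae_empty_or_univ_of_ae_le_preimage hm
      (Eventually.of_forall fun x (hx : ∀ n, x n ≠ 0) n => hx (n + 1)) with h | h
    · exact ae_eq_empty.1 h
    · exfalso
      rw [ae_eq_univ] at h
      refine hν0.ne' (measure_mono_null ?_ h)
      rw [hcyl]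
      exact fun x (hx : x 0 = 0) hx' => hx' 0 hx
  have h := tendsto_measure_iInter_atTop (μ := ν) (fun M => (hmeas M).nullMeasurableSet)
    (fun M M' hMM' x hx hx' => hx (List.map_subset _ (by simpa using hMM') hx'))
    ⟨0, measure_ne_top _ _⟩
  rw [hZ, h0] at h
  exact (ENNReal.tendsto_toReal ENNReal.zero_ne_top).comp h

lemma IsGeneric.tendsto_frequency_zero (hω : IsGeneric ν ω) :
    Tendsto (fun n : ℕ => (∑ j ∈ Finset.range n, if ω j = 0 then (1 : ℝ) else 0) / n)
      atTop (𝓝 (ν.real (wordCylinder [0]))) := by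
  have h := hω.tendsto_frequency 1 (fun w => w = [0])
  simpa [wordCylinder, initialWord, shift_iterate_apply] using h

lemma IsGeneric.exists_ge_eq_zero [IsProbabilityMeasure ν] (hω : IsGeneric ν ω)
    (hν0 : 0 < ν (wordCylinder [0])) (n : ℕ) : ∃ j ≥ n, ω j = 0 := by
  by_contra! h
  have h1 := hω.tendsto_frequency_zero
  have h2 : Tendsto (fun N : ℕ => (∑ j ∈ Finset.range N, if ω j = 0 then (1 : ℝ) else 0) / N)
      atTop (𝓝 0) := by
    refine squeeze_zero (fun N => by positivity) (fun N => ?_)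
      (tendsto_const_div_atTop_nhds_zero_nat (n : ℝ))
    gcongr
    rw [← Finset.sum_filter]
    simp only [Finset.sum_const, nsmul_eq_mul, mul_one]
    have : (Finset.range N).filter (fun j => ω j = 0) ⊆ Finset.range n := fun j hj => by
      simp only [Finset.mem_filter, Finset.mem_range] at hj ⊢
      by_contra hn
      exact h j (by omega) hj.2
    exact_mod_cast (Finset.card_le_card this).trans (by simp)
  have h3 := tendsto_nhds_unique h1 h2
  exact (ENNReal.toReal_pos hν0.ne' (measure_ne_top _ _)).ne' h3

lemma IsGeneric.tendsto_frequency_return (hω : IsGeneric ν ω) {w : List (Fin m)}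
    (hw : (0 : Fin m) ∉ w) :
    Tendsto (fun n : ℕ =>
      (∑ j ∈ Finset.range n, if ω j = 0 ∧ runWord ω j = w then (1 : ℝ) else 0) / n)
      atTop (𝓝 (ν.real (wordCylinder (0 :: (w ++ [0]))))) := by
  have h := hω.tendsto_frequency (w.length + 2) (fun w' => w' = 0 :: (w ++ [0]))
  have hc : (wordCylinder (0 :: (w ++ [0])) : Set (ℕ → Fin m)) =
      {x | initialWord x (w.length + 2) = 0 :: (w ++ [0])} := by
    simp [wordCylinder]
  rw [hc]
  refine tendsto_average_of_add_eq (r := w.length + 1) (fun k => ?_) h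
  simp only [zero_and_runWord_eq_iff ω k w hw]

lemma IsGeneric.tendsto_frequency_long_run (hω : IsGeneric ν ω) (M : ℕ) :
    Tendsto (fun n : ℕ =>
      (∑ j ∈ Finset.range n, if M ≤ (runWord ω j).length then (1 : ℝ) else 0) / n)
      atTop (𝓝 (ν.real {x | (0 : Fin m) ∉ initialWord x M})) := by
  refine tendsto_average_of_add_eq (r := M) (fun k => ?_)
    (hω.tendsto_frequency M (fun w => (0 : Fin m) ∉ w))
  simp only [le_length_runWord_iff]

lemma IsGeneric.tendsto_length_runWord_div [IsProbabilityMeasure ν] (hω : IsGeneric ν ω)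
    (hν : Ergodic shift ν) (hν0 : 0 < ν (wordCylinder [0])) :
    Tendsto (fun n : ℕ => ((runWord ω n).length : ℝ) / n) atTop (𝓝 0) := by
  refine tendsto_of_approx (y := fun _ _ => 0) (Y := fun _ => 0)
    (e := fun M n => (M : ℝ) / n +
      (∑ j ∈ Finset.range n, if M ≤ (runWord ω j).length then (1 : ℝ) else 0) / n)
    (fun _ => tendsto_const_nhds)
    (fun M => (tendsto_const_div_atTop_nhds_zero_nat (M : ℝ)).add
      (hω.tendsto_frequency_long_run M)) ?_ tendsto_const_nhds
    (by simpa using tendsto_measureReal_zero_notMem hν hν0)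
  filter_upwards [eventually_ge_atTop 1] with M hM n
  have h := sum_long_runs_le ω hM n
  rw [sub_zero, abs_of_nonneg (by positivity), ← add_div]
  gcongr
  have h' : (runWord ω n).length ≤
      M + ∑ j ∈ Finset.range n, if M ≤ (runWord ω j).length then 1 else 0 := by omega
  exact_mod_cast h'

lemma sum_return_eq (x : ℕ → Fin m) (s : Finset (List (Fin m))) (g : List (Fin m) → ℝ) (n : ℕ) :
    ∑ j ∈ Finset.range n, (if x j = 0 ∧ runWord x j ∈ s then g (runWord x j) else 0) =
      ∑ w ∈ s, (∑ j ∈ Finset.range n, if x j = 0 ∧ runWord x j = w then (1 : ℝ) else 0) * g w := by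
  simp only [Finset.sum_mul]
  rw [Finset.sum_comm]
  refine Finset.sum_congr rfl fun j _ => ?_
  by_cases h : x j = 0 <;> simp [h, ite_mul]

lemma IsGeneric.tendsto_finset_average (hω : IsGeneric ν ω) (s : Finset (List (Fin m)))
    (g : List (Fin m) → ℝ) (hg : ∀ w, (0 : Fin m) ∈ w → g w = 0) :
    Tendsto (fun n : ℕ => (∑ j ∈ Finset.range n,
        if ω j = 0 ∧ runWord ω j ∈ s then g (runWord ω j) else 0) / n)
      atTop (𝓝 (∑ w ∈ s, ν.real (wordCylinder (0 :: (w ++ [0]))) * g w)) := by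
  simp only [sum_return_eq, Finset.sum_div]
  refine tendsto_finsetSum _ fun w _ => ?_
  by_cases hw : (0 : Fin m) ∈ w
  · simp [hg w hw]
  · simp only [mul_div_right_comm]
    exact (hω.tendsto_frequency_return hw).mul_const _

/-- Finite sums of absolute values are limits of averages, each at most `C` because completed runs,
with their closing zeros, occupy disjoint stretches of the first `n` letters. -/
lemma IsGeneric.summable_return (hω : IsGeneric ν ω) (g : List (Fin m) → ℝ)
    (hg : ∀ w, (0 : Fin m) ∈ w → g w = 0) (C : ℝ) (hC : ∀ w, |g w| ≤ C * (w.length + 1)) :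
    Summable fun w => ν.real (wordCylinder (0 :: (w ++ [0]))) * g w := by
  have hC0 : 0 ≤ C := by simpa using (abs_nonneg _).trans (hC [])
  refine Summable.of_norm (summable_of_sum_le (c := C) (fun _ => norm_nonneg _) fun s => ?_)
  have h := hω.tendsto_finset_average s (fun w => |g w|) fun w hw => by simp [hg w hw]
  simp only [norm_mul, Real.norm_eq_abs, abs_of_nonneg measureReal_nonneg]
  refine le_of_tendsto' h fun n => div_le_of_le_mul₀ (by positivity) hC0 ?_
  calc ∑ j ∈ Finset.range n, (if ω j = 0 ∧ runWord ω j ∈ s then |g (runWord ω j)| else 0)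
      ≤ ∑ j ∈ Finset.range n,
        C * ((if ω j = 0 then (runWord ω j).length + 1 else 0 : ℕ) : ℝ) := by
        refine Finset.sum_le_sum fun j _ => ?_
        by_cases h0 : ω j = 0
        · by_cases hs : runWord ω j ∈ s
          · simpa [h0, hs] using hC (runWord ω j)
          · simp only [h0, hs, and_false, if_false]
            positivity
        · simp [h0]
    _ ≤ C * n := by
        rw [← Finset.mul_sum]
        gcongr
        exact_mod_cast (Nat.le_add_right _ _).trans (sum_runs_add_length ω n).le

/-- Birkhoff averages over the completed returns converge for functions of the return word which
grow at most linearly with its length. -/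
lemma IsGeneric.tendsto_return_average [IsProbabilityMeasure ν] (hω : IsGeneric ν ω)
    (hν : Ergodic shift ν) (hν0 : 0 < ν (wordCylinder [0])) (g : List (Fin m) → ℝ)
    (hg : ∀ w, (0 : Fin m) ∈ w → g w = 0) (C : ℝ) (hC : ∀ w, |g w| ≤ C * (w.length + 1)) :
    Tendsto (fun n : ℕ => (∑ j ∈ Finset.range n, if ω j = 0 then g (runWord ω j) else 0) / n)
      atTop (𝓝 (∑' w, ν.real (wordCylinder (0 :: (w ++ [0]))) * g w)) := by
  have hC0 : 0 ≤ C := by simpa using (abs_nonneg _).trans (hC [])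
  -- Truncation at length `2 * M` matches the threshold of `sum_long_runs_le`; the alphabet being
  -- finite, only finitely many words remain.
  let F : ℕ → Finset (List (Fin m)) := fun M => (List.finite_length_lt (Fin m) (2 * M)).toFinset
  have hF : ∀ M w, w ∈ F M ↔ w.length < 2 * M := by simp [F]
  have hFt : Tendsto F atTop atTop := tendsto_atTop_finset_of_monotone
    (fun M M' h w hw => by rw [hF] at *; omega)
    (fun w => ⟨w.length + 1, by rw [hF]; omega⟩)
  refine tendsto_of_approx (fun M => hω.tendsto_finset_average (F M) g hg)
    (fun M => ((hω.tendsto_frequency_long_run M).const_mul (C * 3))) ?_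
    ((hω.summable_return g hg C hC).hasSum.comp hFt)
    (by simpa using (tendsto_measureReal_zero_notMem hν hν0).const_mul (C * 3))
  filter_upwards [eventually_ge_atTop 1] with M hM n
  have h := (Nat.le_add_right _ _).trans (sum_long_runs_le ω hM n)
  rw [← sub_div, ← Finset.sum_sub_distrib, abs_div, Nat.abs_cast, ← mul_div_assoc]
  gcongr
  calc _ ≤ ∑ j ∈ Finset.range n, C * ((if ω j = 0 ∧ 2 * M ≤ (runWord ω j).length
        then (runWord ω j).length + 1 else 0 : ℕ) : ℝ) := by
        refine (Finset.abs_sum_le_sum_abs _ _).trans (Finset.sum_le_sum fun j _ => ?_)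
        simp only [hF]
        by_cases h0 : ω j = 0
        · by_cases hs : 2 * M ≤ (runWord ω j).length
          · simpa [h0, hs, not_lt.2 hs] using hC (runWord ω j)
          · simp [h0, not_le.1 hs, hs]
        · simp [h0]
    _ ≤ _ := by
        rw [← Finset.mul_sum, mul_assoc]
        gcongr
        exact_mod_cast h

end Generic

/-! ### Comparison of norms with matrix entries -/

section Seminorm

variable {E : Type*} [AddCommGroup E] [Module ℝ E]

/-- On a finite-dimensional space a linear functional is bounded with respect to any norm. -/
lemma exists_abs_le_mul_seminorm [FiniteDimensional ℝ E] (N : Seminorm ℝ E)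
    (hN : ∀ x, N x = 0 → x = 0) (f : E →ₗ[ℝ] ℝ) : ∃ c : ℝ, ∀ x, |f x| ≤ c * N x := by
  let G : AddGroupNorm E := { N.toAddGroupSeminorm with eq_zero_of_map_eq_zero' := hN }
  let _ : NormedAddCommGroup E := G.toNormedAddCommGroup
  let _ : NormedSpace ℝ E := ⟨fun a b => (map_smul_eq_mul N a b).le⟩
  exact ⟨‖f.toContinuousLinearMap‖, fun x => f.toContinuousLinearMap.le_opNorm x⟩

lemma exists_seminorm_le_mul {d : ℕ} (N : Seminorm ℝ (Matrix (Fin d) (Fin d) ℝ)) :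
    ∃ c > 0, ∀ (M : Matrix (Fin d) (Fin d) ℝ) (b : ℝ), 0 ≤ b → (∀ i j, |M i j| ≤ b) →
      N M ≤ c * b := by
  refine ⟨1 + ∑ i, ∑ j, N (Matrix.single i j 1), by positivity, fun M b hb hM => ?_⟩
  have h : N M ≤ ∑ i, ∑ j, N (Matrix.single i j 1) * b := by
    conv_lhs => rw [Matrix.matrix_eq_sum_single M]
    refine (Finset.le_sum_of_subadditive N (map_zero N).le (map_add_le_add N) _ _).trans ?_
    refine Finset.sum_le_sum fun i _ => ?_
    refine (Finset.le_sum_of_subadditive N (map_zero N).le (map_add_le_add N) _ _).trans ?_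
    refine Finset.sum_le_sum fun j _ => ?_
    have : Matrix.single i j (M i j) = M i j • Matrix.single i j (1 : ℝ) := by simp
    rw [this, map_smul_eq_mul, mul_comm]
    gcongr
    exact hM i j
  simp only [← Finset.sum_mul] at h
  linarith

end Seminorm

/-! ### Growth of products and the rank-one factorization -/

section Matrices

variable {m d : ℕ} (A : Fin m → Matrix (Fin d) (Fin d) ℝ)

lemma wordProd_nil : wordProd A [] = 1 := by simp [wordProd]

lemma wordProd_cons (a : Fin m) (w : List (Fin m)) :
    wordProd A (a :: w) = A a * wordProd A w := by simp [wordProd]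

lemma wordProd_append (w w' : List (Fin m)) :
    wordProd A (w ++ w') = wordProd A w * wordProd A w' := by simp [wordProd]

lemma wordProd_singleton (a : Fin m) : wordProd A [a] = A a := by simp [wordProd]

variable {A}

lemma wordProd_nonneg (hA : ∀ a i j, 0 ≤ A a i j) (w : List (Fin m)) (i j : Fin d) :
    0 ≤ wordProd A w i j := by
  induction w generalizing i with
  | nil =>
    rw [wordProd_nil, Matrix.one_apply]
    positivity
  | cons a w ih =>
    rw [wordProd_cons, Matrix.mul_apply]
    exact Finset.sum_nonneg fun k _ => mul_nonneg (hA a i k) (ih k)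

/-- Entries of products of non-negative matrices from a finite family are either zero or
exponentially bounded above and below in the length of the word. -/
lemma exists_wordProd_bounds (hA : ∀ a i j, 0 ≤ A a i j) : ∃ B ≥ 0, ∀ w i j,
    wordProd A w i j ≤ Real.exp (B * w.length) ∧
      (wordProd A w i j ≠ 0 → Real.exp (-(B * w.length)) ≤ wordProd A w i j) := by
  have h1 : ∀ᶠ B in atTop, ∀ a i, ∑ k, A a i k ≤ Real.exp B := by
    simp only [eventually_all]
    exact fun a i => Real.tendsto_exp_atTop.eventually_ge_atTop _
  have h2 : ∀ᶠ B in atTop, ∀ a i j, A a i j ≠ 0 → Real.exp (-B) ≤ A a i j := by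
    simp only [eventually_all]
    intro a i j h
    have hpos := lt_of_le_of_ne (hA a i j) (Ne.symm h)
    exact (Real.tendsto_exp_neg_atTop_nhds_zero.eventually (gt_mem_nhds hpos)).mono
      fun _ h => h.le
  obtain ⟨B, hB, h1, h2⟩ := ((eventually_ge_atTop 0).and (h1.and h2)).exists
  refine ⟨B, hB, fun w => ?_⟩
  induction w with
  | nil =>
    intro i j
    rw [wordProd_nil, Matrix.one_apply]
    split_ifs <;> simp
  | cons a w ih =>
    intro i j
    rw [wordProd_cons, Matrix.mul_apply]
    have hlen : B * ((a :: w).length : ℕ) = B + B * w.length := by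
      push_cast [List.length_cons]
      ring
    rw [hlen, neg_add, Real.exp_add, Real.exp_add]
    constructor
    · calc ∑ k, A a i k * wordProd A w k j ≤ ∑ k, A a i k * Real.exp (B * w.length) :=
            Finset.sum_le_sum fun k _ => mul_le_mul_of_nonneg_left (ih k j).1 (hA a i k)
        _ ≤ _ := by
            rw [← Finset.sum_mul]
            gcongr
            exact h1 a i
    · intro hne
      -- No cancellation occurs among non-negative summands, so a single nonzero one bounds the
      -- entry from below.
      obtain ⟨k, -, hk⟩ := Finset.exists_ne_zero_of_sum_ne_zero hne
      calc _ ≤ A a i k * wordProd A w k j :=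
            mul_le_mul (h2 a i k (left_ne_zero_of_mul hk)) ((ih k j).2 (right_ne_zero_of_mul hk))
              (Real.exp_pos _).le (hA a i k)
        _ ≤ _ := Finset.single_le_sum (f := fun k => A a i k * wordProd A w k j)
            (fun k _ => mul_nonneg (hA a i k) (wordProd_nonneg hA w k j)) (Finset.mem_univ k)

/-- Applied to `w ++ [0]`, whose trace is `v' A_w u`. A zero trace is harmless because `Real.log 0 =
0`. -/
lemma exists_log_trace_wordProd_bound (hA : ∀ a i j, 0 ≤ A a i j) : ∃ C ≥ 0, ∀ w : List (Fin m),
    |Real.log (wordProd A w).trace| ≤ C * (w.length + 1) := by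
  obtain ⟨B, hB, h⟩ := exists_wordProd_bounds hA
  have hd : 0 ≤ Real.log d := Real.log_natCast_nonneg d
  refine ⟨B + Real.log d, by positivity, fun w => ?_⟩
  by_cases hne : (wordProd A w).trace = 0
  · rw [hne, Real.log_zero, abs_zero]
    positivity
  obtain ⟨i, -, hi⟩ := Finset.exists_ne_zero_of_sum_ne_zero (f := fun i => wordProd A w i i) hne
  have hlow : Real.exp (-(B * w.length)) ≤ (wordProd A w).trace :=
    ((h w i i).2 hi).trans (Finset.single_le_sum (f := fun i => wordProd A w i i)
      (fun k _ => wordProd_nonneg hA w k k) (Finset.mem_univ i))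
  have hup : (wordProd A w).trace ≤ d * Real.exp (B * w.length) := by
    refine (Finset.sum_le_sum fun i _ => (h w i i).1).trans ?_
    simp
  have hpos := (Real.exp_pos _).trans_le hlow
  have hd0 : (d : ℝ) ≠ 0 := by
    rintro hd0
    rw [hd0, zero_mul] at hup
    linarith
  have h1 := (Real.le_log_iff_exp_le hpos).2 hlow
  have h2 := Real.log_le_log hpos hup
  rw [Real.log_mul hd0 (Real.exp_pos _).ne', Real.log_exp] at h2
  have h3 : 0 ≤ Real.log d * w.length := by positivity
  rw [abs_le]
  constructor <;> nlinarith

lemma exists_log_seminorm_wordProd_bound (N : Seminorm ℝ (Matrix (Fin d) (Fin d) ℝ))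
    (hN : ∀ M, N M = 0 → M = 0) (hA : ∀ a i j, 0 ≤ A a i j) :
    ∃ C ≥ 0, ∀ w : List (Fin m), |Real.log (N (wordProd A w))| ≤ C * (w.length + 1) := by
  obtain ⟨B, hB, h⟩ := exists_wordProd_bounds hA
  obtain ⟨c₂, hc₂, hup⟩ := exists_seminorm_le_mul N
  have h1 : ∀ i j, ∃ c : ℝ, ∀ M : Matrix (Fin d) (Fin d) ℝ, |M i j| ≤ c * N M :=
    fun i j => exists_abs_le_mul_seminorm N hN (Matrix.entryLinearMap ℝ ℝ i j)
  choose c hc using h1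
  have h2 : ∀ᶠ b in atTop, ∀ i j, c i j ≤ b := by
    simp only [eventually_all]
    exact fun i j => eventually_ge_atTop _
  obtain ⟨c₁, hc₁, hlow⟩ := ((eventually_gt_atTop 0).and h2).exists
  refine ⟨B + |Real.log c₁| + |Real.log c₂|, by positivity, fun w => ?_⟩
  by_cases hne : wordProd A w = 0
  · rw [hne, map_zero, Real.log_zero, abs_zero]
    positivity
  have hpos : 0 < N (wordProd A w) :=
    lt_of_le_of_ne (apply_nonneg N _) fun h0 => hne (hN _ h0.symm)
  obtain ⟨i, j, hij⟩ : ∃ i j, wordProd A w i j ≠ 0 := by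
    by_contra! h0
    exact hne (Matrix.ext h0)
  have hl : Real.exp (-(B * w.length)) ≤ c₁ * N (wordProd A w) :=
    ((h w i j).2 hij).trans ((le_abs_self _).trans ((hc i j _).trans (by gcongr; exact hlow i j)))
  have hu : N (wordProd A w) ≤ c₂ * Real.exp (B * w.length) :=
    hup _ _ (Real.exp_pos _).le fun i j => by
      rw [abs_of_nonneg (wordProd_nonneg hA w i j)]
      exact (h w i j).1
  have h1 := (Real.le_log_iff_exp_le (by positivity)).2 hl
  rw [Real.log_mul hc₁.ne' hpos.ne'] at h1
  have h2 := Real.log_le_log hpos hu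
  rw [Real.log_mul hc₂.ne' (Real.exp_pos _).ne', Real.log_exp] at h2
  have h3 : 0 ≤ (|Real.log c₁| + |Real.log c₂|) * w.length := by positivity
  have h4 := le_abs_self (Real.log c₁)
  have h5 := le_abs_self (Real.log c₂)
  have h6 := abs_nonneg (Real.log c₁)
  have h7 := abs_nonneg (Real.log c₂)
  rw [abs_le]
  constructor <;> nlinarith

variable [NeZero m] {u v : Fin d → ℝ}

lemma trace_wordProd_append_zero (hA0 : A 0 = Matrix.vecMulVec u v) (w : List (Fin m)) :
    (wordProd A (w ++ [0])).trace = v ⬝ᵥ Matrix.mulVec (wordProd A w) u := by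
  rw [wordProd_append, wordProd_singleton, hA0, Matrix.mul_vecMulVec, Matrix.trace_vecMulVec,
    dotProduct_comm]

/-- Factorization of the matrix product along the occurrences of the letter of rank one. -/
lemma wordProd_initialWord_eq_smul (hA0 : A 0 = Matrix.vecMulVec u v) {ω : ℕ → Fin m} {t : ℕ}
    (ht : ω t = 0) {n : ℕ} (hn : t + 1 ≤ n) :
    wordProd A (initialWord ω n) =
      (∏ j ∈ Finset.Ico (t + 1) n,
        if ω j = 0 then v ⬝ᵥ Matrix.mulVec (wordProd A (runWord ω j)) u else 1) •
      wordProd A (initialWord ω t ++ 0 :: runWord ω n) := by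
  induction n, hn using Nat.le_induction with
  | base => rw [runWord_succ_of_eq ω ht, initialWord_succ, ht]; simp
  | succ n hn ih =>
    rw [initialWord_succ, wordProd_append, ih, Finset.prod_Ico_succ_top hn, wordProd_singleton]
    by_cases h : ω n = 0
    · rw [runWord_succ_of_eq ω h, if_pos h, h, wordProd_append, wordProd_append, wordProd_cons,
        wordProd_cons, wordProd_nil, mul_one, hA0, smul_mul_assoc, mul_smul, mul_assoc, mul_assoc,
        Matrix.mul_vecMulVec, Matrix.vecMulVec_mul_vecMulVec, Matrix.vecMulVec_smul,
        Matrix.mul_smul]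
    · rw [runWord_succ_of_ne ω h, if_neg h, mul_one, smul_mul_assoc, ← wordProd_singleton A (ω n),
        ← wordProd_append, List.append_assoc, List.cons_append]

end Matrices

/-! ### The Lyapunov exponent: degenerate and regular cases -/

section Lyapunov

variable {m d : ℕ} {N : Seminorm ℝ (Matrix (Fin d) (Fin d) ℝ)}
  {A : Fin m → Matrix (Fin d) (Fin d) ℝ} {u v : Fin d → ℝ}
  {ν : Measure (ℕ → Fin m)} {ω : ℕ → Fin m}

lemma isLyapunovExponent_bot (h : ∀ᶠ n in atTop, wordProd A (initialWord ω n) = 0) :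
    IsLyapunovExponent N A ω ⊥ := by
  refine tendsto_const_nhds.congr' ?_
  -- The index `0` is excluded because `⊥ / 0 = 0` in `EReal`.
  filter_upwards [h, eventually_ge_atTop 1] with n hn hn1
  rw [hn, map_zero, ENNReal.ofReal_zero, ENNReal.log_zero,
    EReal.bot_div_of_pos_ne_top (by exact_mod_cast hn1) (EReal.natCast_ne_top n)]

lemma isLyapunovExponent_coe {L : ℝ}
    (hpos : ∀ᶠ n in atTop, 0 < N (wordProd A (initialWord ω n)))
    (h : Tendsto (fun n : ℕ => Real.log (N (wordProd A (initialWord ω n))) / n) atTop (𝓝 L)) :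
    IsLyapunovExponent N A ω L := by
  refine ((continuous_coe_real_ereal.tendsto L).comp h).congr' ?_
  filter_upwards [hpos] with n hn
  rw [ENNReal.log_ofReal_of_pos hn, Function.comp_apply, EReal.coe_div]
  rfl

variable [NeZero m]

lemma wordProd_initialWord_eventually_eq_zero (hA0 : A 0 = Matrix.vecMulVec u v) {t : ℕ}
    (ht : ω t = 0) (hmin : ∀ i, ω i = 0 → t ≤ i)
    (h : Matrix.mulVec (wordProd A (initialWord ω t)) u = 0 ∨
      ∃ w ∈ returnWords ω, v ⬝ᵥ Matrix.mulVec (wordProd A w) u = 0) :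
    ∀ᶠ n in atTop, wordProd A (initialWord ω n) = 0 := by
  rcases h with h | ⟨w, hw, hw0⟩
  · filter_upwards [eventually_ge_atTop (t + 1)] with n hn
    rw [wordProd_initialWord_eq_smul hA0 ht hn, wordProd_append, wordProd_cons, hA0, ← mul_assoc,
      Matrix.mul_vecMulVec, h, Matrix.zero_vecMulVec, zero_mul, smul_zero]
  · obtain ⟨i, j, hij, hi, hj, rfl⟩ := exists_runWord_eq_of_mem_returnWords ω hw
    filter_upwards [eventually_ge_atTop (j + 1)] with n hn
    have := hmin i hi
    rw [wordProd_initialWord_eq_smul hA0 ht (by omega),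
      Finset.prod_eq_zero (i := j) (by simp; omega) (by rw [if_pos hj, hw0]), zero_smul]

/-- A product that vanishes once vanishes forever, so it suffices to look just after a later zero of
`ω`, where the factorization is a nonzero scalar times `(A_{w₀} u) v'`. -/
lemma wordProd_initialWord_ne_zero (hA0 : A 0 = Matrix.vecMulVec u v) (hv : v ≠ 0) {t : ℕ}
    (ht : ω t = 0) (hu : Matrix.mulVec (wordProd A (initialWord ω t)) u ≠ 0)
    (hc : ∀ j, t < j → ω j = 0 → v ⬝ᵥ Matrix.mulVec (wordProd A (runWord ω j)) u ≠ 0)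
    (hinf : ∀ n, ∃ j ≥ n, ω j = 0) (n : ℕ) : wordProd A (initialWord ω n) ≠ 0 := by
  intro h0
  have hmono : ∀ k ≥ n, wordProd A (initialWord ω k) = 0 := by
    intro k hk
    induction k, hk using Nat.le_induction with
    | base => exact h0
    | succ k _ ih => rw [initialWord_succ, wordProd_append, ih, zero_mul]
  obtain ⟨j, hj, hj0⟩ := hinf (max n t)
  have h := hmono (j + 1) (by omega)
  rw [wordProd_initialWord_eq_smul hA0 ht (by omega), runWord_succ_of_eq ω hj0, wordProd_append,
    wordProd_singleton, hA0, Matrix.mul_vecMulVec, smul_eq_zero, Finset.prod_eq_zero_iff,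
    Matrix.vecMulVec_eq_zero] at h
  rcases h with ⟨i, hi, hi0⟩ | h | h
  · rw [Finset.mem_Ico] at hi
    split_ifs at hi0 with hi1
    · exact hc i (by omega) hi1 hi0
    · exact one_ne_zero hi0
  · exact hu h
  · exact hv h

lemma log_norm_wordProd_initialWord (hA0 : A 0 = Matrix.vecMulVec u v) {t : ℕ} (ht : ω t = 0)
    (hc : ∀ j, t < j → ω j = 0 → v ⬝ᵥ Matrix.mulVec (wordProd A (runWord ω j)) u ≠ 0)
    {n : ℕ} (hn : t + 1 ≤ n) (hpos : 0 < N (wordProd A (initialWord ω n))) :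
    Real.log (N (wordProd A (initialWord ω n))) =
      (∑ j ∈ Finset.Ico (t + 1) n, if ω j = 0
        then Real.log (v ⬝ᵥ Matrix.mulVec (wordProd A (runWord ω j)) u) else 0) +
      Real.log (N (wordProd A (initialWord ω t ++ 0 :: runWord ω n))) := by
  rw [wordProd_initialWord_eq_smul hA0 ht hn, map_smul_eq_mul] at hpos ⊢
  have h1 : ∀ j ∈ Finset.Ico (t + 1) n,
      (if ω j = 0 then v ⬝ᵥ Matrix.mulVec (wordProd A (runWord ω j)) u else 1) ≠ 0 := by
    intro j hj
    rw [Finset.mem_Ico] at hj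
    split_ifs with h
    · exact hc j (by omega) h
    · exact one_ne_zero
  rw [Real.log_mul (left_ne_zero_of_mul hpos.ne') (right_ne_zero_of_mul hpos.ne'),
    Real.norm_eq_abs, Real.log_abs, Real.log_prod h1]
  congr 1
  refine Finset.sum_congr rfl fun j _ => ?_
  split_ifs <;> simp

lemma tendsto_log_norm_tail_div [IsProbabilityMeasure ν] (hN : ∀ M, N M = 0 → M = 0)
    (hA : ∀ a i j, 0 ≤ A a i j) (hν : Ergodic shift ν) (hν0 : 0 < ν (wordCylinder [0]))
    (hω : IsGeneric ν ω) (w : List (Fin m)) :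
    Tendsto (fun n : ℕ => Real.log (N (wordProd A (w ++ 0 :: runWord ω n))) / n)
      atTop (𝓝 0) := by
  obtain ⟨C, -, hC⟩ := exists_log_seminorm_wordProd_bound N hN hA
  have h := ((tendsto_const_div_atTop_nhds_zero_nat (C * (w.length + 2))).add
    ((hω.tendsto_length_runWord_div hν hν0).const_mul C))
  rw [mul_zero, add_zero] at h
  refine squeeze_zero_norm (fun n => ?_) h
  rw [Real.norm_eq_abs, abs_div, Nat.abs_cast, ← mul_div_assoc, ← add_div]
  gcongr
  refine (hC _).trans_eq ?_
  push_cast [List.length_append, List.length_cons]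
  ring

end Lyapunov

end MatrixWords

theorem mainTheorem2 {m d : ℕ} [NeZero m]
    (N : Seminorm ℝ (Matrix (Fin d) (Fin d) ℝ)) (hN : ∀ M, N M = 0 → M = 0)
    (A : Fin m → Matrix (Fin d) (Fin d) ℝ) (hA : ∀ a i j, 0 ≤ A a i j)
    (u v : Fin d → ℝ) (hA0 : A 0 = Matrix.vecMulVec u v) (huv : v ⬝ᵥ u ≠ 0)
    (ν : Measure (ℕ → Fin m)) [IsProbabilityMeasure ν] (hν : Ergodic MatrixWords.shift ν)
    (hν0 : 0 < ν (MatrixWords.wordCylinder [0]))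
    (ω : ℕ → Fin m) (hω : MatrixWords.IsGeneric ν ω) :
    ∃ L : EReal, MatrixWords.IsLyapunovExponent N A ω L ∧
      ((Matrix.mulVec (MatrixWords.wordProd A (MatrixWords.firstWord ω)) u = 0 ∨
          ∃ w ∈ MatrixWords.returnWords ω,
            v ⬝ᵥ Matrix.mulVec (MatrixWords.wordProd A w) u = 0) →
        L = ⊥) ∧
      (¬ (Matrix.mulVec (MatrixWords.wordProd A (MatrixWords.firstWord ω)) u = 0 ∨
          ∃ w ∈ MatrixWords.returnWords ω,
            v ⬝ᵥ Matrix.mulVec (MatrixWords.wordProd A w) u = 0) →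
        ∃ s : ℝ,
          HasSum (fun w : MatrixWords.returnWords ω =>
            ν.real (MatrixWords.wordCylinder (0 :: ((w : List (Fin m)) ++ [0]))) *
              Real.log ((v ⬝ᵥ Matrix.mulVec (MatrixWords.wordProd A w) u) / (v ⬝ᵥ u))) s ∧
          L = ((ν.real (MatrixWords.wordCylinder [0]) * Real.log (v ⬝ᵥ u) + s : ℝ) : EReal)) := by
  classical
  open MatrixWords in
  have hinf := hω.exists_ge_eq_zero hν0
  set t := sInf {n | ω n = 0} with htdef
  have ht : ω t = 0 := Nat.sInf_mem (s := {n | ω n = 0}) ((hinf 0).imp fun _ h => h.2)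
  have hmin : ∀ i, ω i = 0 → t ≤ i := fun i hi => Nat.sInf_le hi
  have hfirst : firstWord ω = initialWord ω t := rfl
  rw [hfirst]
  by_cases hdeg : Matrix.mulVec (wordProd A (initialWord ω t)) u = 0 ∨
      ∃ w ∈ returnWords ω, v ⬝ᵥ Matrix.mulVec (wordProd A w) u = 0
  · exact ⟨⊥, isLyapunovExponent_bot
      (wordProd_initialWord_eventually_eq_zero hA0 ht hmin hdeg), fun _ => rfl,
      fun h => absurd hdeg h⟩
  obtain ⟨hu, hR⟩ := not_or.1 hdeg
  push Not at hR
  have hv : v ≠ 0 := by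
    rintro rfl
    exact huv (zero_dotProduct u)
  have hc : ∀ j, t < j → ω j = 0 →
      v ⬝ᵥ Matrix.mulVec (wordProd A (runWord ω j)) u ≠ 0 := by
    intro j hj hj0
    by_cases hnil : runWord ω j = []
    · rwa [hnil, wordProd_nil, Matrix.one_mulVec]
    · exact hR _ (runWord_mem_returnWords ω ht hj hj0 hnil)
  have hpos : ∀ n, 0 < N (wordProd A (initialWord ω n)) := fun n =>
    lt_of_le_of_ne (apply_nonneg N _) fun h =>
      wordProd_initialWord_ne_zero hA0 hv ht hu hc hinf n (hN _ h.symm)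
  -- Extension by zero to all words. In particular `g [] = 0`, so an empty run adds only `log v'u`.
  let g : List (Fin m) → ℝ := fun w => if w ∈ returnWords ω then
    Real.log ((v ⬝ᵥ Matrix.mulVec (wordProd A w) u) / (v ⬝ᵥ u)) else 0
  have hg0 : ∀ w, (0 : Fin m) ∈ w → g w = 0 := fun w hw => if_neg fun h => h.2.1 hw
  obtain ⟨C, hC0, hC⟩ := exists_log_trace_wordProd_bound hA
  -- The word `w ++ [0]` has length `w.length + 1`, and `C * (w.length + 2) ≤ 2 * C * (w.length +
  -- 1)`.
  have hgC : ∀ w, |g w| ≤ (2 * C + |Real.log (v ⬝ᵥ u)|) * (w.length + 1) := by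
    intro w
    by_cases hw : w ∈ returnWords ω
    · have h1 := hC (w ++ [0])
      rw [trace_wordProd_append_zero hA0, List.length_append, List.length_singleton] at h1
      push_cast at h1
      simp only [g, if_pos hw]
      rw [Real.log_div (hR w hw) huv]
      have h2 : 0 ≤ C * w.length := by positivity
      have h3 : 0 ≤ |Real.log (v ⬝ᵥ u)| * w.length := by positivity
      linarith [abs_sub (Real.log (v ⬝ᵥ Matrix.mulVec (wordProd A w) u)) (Real.log (v ⬝ᵥ u))]
    · simp only [g, if_neg hw, abs_zero]
      positivity
  have hsum := (hω.summable_return g hg0 _ hgC).hasSum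
  have havg := hω.tendsto_return_average hν hν0 g hg0 _ hgC
  set s := ∑' w, ν.real (wordCylinder (0 :: (w ++ [0]))) * g w
  let φ : ℕ → ℝ := fun j => if ω j = 0 then Real.log (v ⬝ᵥ u) + g (runWord ω j) else 0
  have hφ : Tendsto (fun n : ℕ => (∑ j ∈ Finset.range n, φ j) / n) atTop
      (𝓝 (ν.real (wordCylinder [0]) * Real.log (v ⬝ᵥ u) + s)) := by
    refine ((hω.tendsto_frequency_zero.mul_const (Real.log (v ⬝ᵥ u))).add havg).congr fun n => ?_
    rw [← mul_div_right_comm, ← add_div, Finset.sum_mul, ← Finset.sum_add_distrib]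
    congr 1
    refine Finset.sum_congr rfl fun j _ => ?_
    simp only [φ]
    split_ifs <;> simp
  have hlog : Tendsto (fun n : ℕ => Real.log (N (wordProd A (initialWord ω n))) / n) atTop
      (𝓝 (ν.real (wordCylinder [0]) * Real.log (v ⬝ᵥ u) + s)) := by
    -- The terms up to the first zero `t` are removed, since the factorization starts at `t + 1`;
    -- their fixed sum is negligible after division by `n`.
    have h := (hφ.sub (tendsto_const_div_atTop_nhds_zero_nat
      (∑ j ∈ Finset.range (t + 1), φ j))).add
      (tendsto_log_norm_tail_div (N := N) (A := A) hN hA hν hν0 hω (initialWord ω t))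
    rw [sub_zero, add_zero] at h
    refine h.congr' ?_
    filter_upwards [eventually_ge_atTop (t + 1)] with n hn
    rw [log_norm_wordProd_initialWord hA0 ht hc hn (hpos n), ← sub_div, ← add_div,
      ← Finset.sum_Ico_eq_sub _ hn]
    congr 2
    refine Finset.sum_congr rfl fun j hj => ?_
    rw [Finset.mem_Ico] at hj
    simp only [φ, g]
    split_ifs with h0 hw
    · rw [Real.log_div (hR _ hw) huv]
      ring
    · have hnil : runWord ω j = [] := by
        by_contra hne
        exact hw (runWord_mem_returnWords ω ht hj.1 h0 hne)
      rw [hnil, wordProd_nil, Matrix.one_mulVec, add_zero]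
    · rfl
  refine ⟨_, isLyapunovExponent_coe (Eventually.of_forall hpos) hlog, fun h => absurd h hdeg,
    fun _ => ⟨s, ?_, rfl⟩⟩
  rw [← hasSum_subtype_iff_of_support_subset (s := returnWords ω)] at hsum
  · refine hsum.congr_fun fun w => ?_
    simp [g, w.2]
  · intro w hw
    by_contra hn
    exact hw (by simp [g, hn])
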